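/- All functions on $(0,1)$ are complex valued unless stated otherwise. Let $q\in C[0,1]$ be real valued, $\chi_2\in L^\infty(0,1)$ and $0\neq f\in L^2(0,1)$. Let $H^2_\diamond=\{u\in H^2(0,1):u(0)=0\}$, with inner product $\langle u,v\rangle_{L^2}+\langle u'',v''\rangle_{L^2}$, and let $X_\diamond=H^2_\diamond\times L^2(0,1)$ be the product Hilbert space. For $\omega\in\mathbb C$, $\chi_1\in L^\infty(0,1)$ and $\mathbf u=(u_1,u_2)\in X_\diamond$ let $T^\diamond_\omega(\mathbf u)\in X_\diamond$ be the element determined by $$\langle T^\diamond_\omega(\mathbf u),\boldsymbol\phi\rangle_{X_\diamond}=\int_0^1\Big[(u_1''+\omega^2qu_1)\overline{\phi_2}+\frac{\omega^2}{x}\chi_1u_2\overline{u_1}\,\overline{\phi_2}\Big]dx+\int_0^1\Big[u_2\big(\overline{\phi_1}''+4\omega^2q\,\overline{\phi_1}\big)+\frac{\omega^2}{x}\chi_2u_1^2\,\overline{\phi_1}\Big]dx$$ for all $\boldsymbol\phi=(\phi_1,\phi_2)\in X_\diamond$. Let $z_\omega,\widetilde z_\omega$ be the solutions of $z''+\omega^2qz=0$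 on $[0,1]$ with $z_\omega(0)=0,\ z_\omega'(0)=1$ and $\widetilde z_\omega(0)=1,\ \widetilde z_\omega'(0)=0$, and let $$a_\omega(x)=\int_0^x\big[z_\omega(x)\widetilde z_\omega(t)-z_\omega(t)\widetilde z_\omega(x)\big]f(t)\,dt ,$$ $$\zeta(\omega)=\Big(\int_0^1z_\omega a_\omega z_{2\omega}\frac{\chi_2\,dx}{x}\Big)^2-\int_0^1z_\omega^2z_{2\omega}\frac{\chi_2\,dx}{x}\cdot\int_0^1a_\omega^2z_{2\omega}\frac{\chi_2\,dx}{x},$$ $$\Lambda=\{\omega\in\mathbb C:\zeta(\omega)=0\}\cup\{0\},\qquad \mathcal G_{\rho,\delta}=\{\omega\in\mathbb C:|\omega|\le\rho,\ \operatorname{dist}(\omega,\Lambda)\ge\delta\}.$$ **Theorem.** For any $\rho,\delta>0$ there exists $c=c(\rho,\delta,f,\chi_2,q)>0$ such that for every $\chi_1\in L^\infty(0,1)$ with $\|\chi_1\|_{L^\infty}<c$ and every $\omega\in\mathcal G_{\rho,\delta}$ the equation $T^\diamond_\omega(\mathbf u)=(0,f)$ has a solution $\mathbf u\in X_\diamond$.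 -/

import Mathlib

open MeasureTheory Set Filter Topology ComplexConjugate

noncomputable section

namespace RadialSHG

/-! ### Function spaces on the interval `(0, 1)` (all functions are complex valued) -/

/-- The interval `(0, 1)`. -/
abbrev D : Set ℝ := Ioo 0 1
/-- Lebesgue measure on `(0, 1)`. -/
abbrev μD : Measure ℝ := volume.restrict D
/-- The Hilbert space `L²(0, 1)`. -/
abbrev L2 : Type := Lp ℂ 2 μD
/-- The space `L^∞(0, 1)`, with the essential supremum norm. -/
abbrev Linfty : Type := Lp ℂ ⊤ μD

/-- `u ∈ H²(0, 1)` with second weak derivative `u'' = w ∈ L²(0, 1)`, witnessed by the `C¹`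
representative `g` of `u` on `[0, 1]`, its derivative `dg` (one-sided at the endpoints), and the
fact that `dg` is absolutely continuous on `[0, 1]` with almost everywhere derivative `w`. -/
structure IsH2Rep (g dg : ℝ → ℂ) (u w : L2) : Prop where
  ae_eq : (u : ℝ → ℂ) =ᵐ[μD] g
  hasDeriv : ∀ x ∈ Icc (0 : ℝ) 1, HasDerivWithinAt g (dg x) (Icc 0 1) x
  deriv_eq : ∀ x ∈ Icc (0 : ℝ) 1, dg x = dg 0 + ∫ t in (0 : ℝ)..x, w t

lemma L2.integrable (w : L2) : Integrable w μD := 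
  (Lp.memLp w).integrable (by norm_num)

instance : IsProbabilityMeasure μD := ⟨by simp [μD, D]⟩

lemma prim_eq (w : L2) {x : ℝ} (hx : x ∈ Icc (0 : ℝ) 1) :
    ∫ t in (0 : ℝ)..x, w t = ∫ t in (0 : ℝ)..x, w t ∂μD := by
  have h : μD.restrict (Ioc 0 x) = volume.restrict (Ioc 0 x) := by
    rw [Measure.restrict_congr_set (μ := μD) Ioo_ae_eq_Ioc.symm,
      Measure.restrict_restrict measurableSet_Ioo,
      inter_eq_self_of_subset_left (Ioo_subset_Ioo_right hx.2)]
    exact Measure.restrict_congr_set Ioo_ae_eq_Ioc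
  rw [intervalIntegral.integral_of_le hx.1, intervalIntegral.integral_of_le hx.1, h]

/-- Auxiliary: the primitive of `w` vanishing at `0`. -/
def W (w : L2) (x : ℝ) : ℂ := ∫ t in (0 : ℝ)..x, w t ∂μD

lemma W_continuous (w : L2) : Continuous (W w) :=
  intervalIntegral.continuous_primitive (fun _ _ => (L2.integrable w).intervalIntegrable) 0

lemma W_add (w v : L2) (x : ℝ) : W (w + v) x = W w x + W v x := by
  unfold W
  rw [← intervalIntegral.integral_add (L2.integrable w).intervalIntegrable
    (L2.integrable v).intervalIntegrable]
  apply intervalIntegral.integral_congr_ae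
  filter_upwards [Lp.coeFn_add w v] with t ht _ using ht

lemma W_smul (c : ℂ) (w : L2) (x : ℝ) : W (c • w) x = c * W w x := by
  unfold W
  rw [← intervalIntegral.integral_const_mul]
  apply intervalIntegral.integral_congr_ae
  filter_upwards [Lp.coeFn_smul c w] with t ht _ using ht

lemma W_norm (w : L2) (x : ℝ) : ‖W w x‖ ≤ ‖w‖ := by
  have h1 : ‖W w x‖ ≤ ∫ t, ‖w t‖ ∂μD := by
    refine (intervalIntegral.norm_integral_le_integral_norm_uIoc).trans ?_
    exact setIntegral_le_integral (L2.integrable w).norm (by filter_upwards with t using norm_nonneg _)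
  refine h1.trans ?_
  have h2 := eLpNorm_le_eLpNorm_of_exponent_le (μ := μD) (p := 1) (q := 2) (by norm_num)
    (Lp.aestronglyMeasurable w)
  rw [Lp.norm_def, integral_norm_eq_lintegral_enorm (Lp.aestronglyMeasurable w),
    ← eLpNorm_one_eq_lintegral_enorm]
  exact ENNReal.toReal_mono (Lp.eLpNorm_ne_top w) h2

/-- Auxiliary: the iterated primitive of `w`. -/
def W2 (w : L2) (x : ℝ) : ℂ := ∫ s in (0 : ℝ)..x, W w s

lemma W2_hasDeriv (w : L2) (x : ℝ) : HasDerivAt (W2 w) (W w x) x :=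
  (W_continuous w).integral_hasStrictDerivAt 0 x |>.hasDerivAt

lemma W2_norm (w : L2) (x : ℝ) (hx : 0 ≤ x) : ‖W2 w x‖ ≤ ‖w‖ * x := by
  have := intervalIntegral.norm_integral_le_of_norm_le_const (a := 0) (b := x) (f := W w) (C := ‖w‖)
    (fun s _ => W_norm w s)
  simpa [W2, abs_of_nonneg hx] using this


lemma W2_add (w v : L2) (x : ℝ) : W2 (w + v) x = W2 w x + W2 v x := by
  unfold W2
  rw [← intervalIntegral.integral_add ((W_continuous w).intervalIntegrable _ _)
    ((W_continuous v).intervalIntegrable _ _)]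
  simp only [W_add]

lemma W2_smul (c : ℂ) (w : L2) (x : ℝ) : W2 (c • w) x = c * W2 w x := by
  unfold W2
  rw [← intervalIntegral.integral_const_mul]
  simp only [W_smul]

lemma W2_continuous (w : L2) : Continuous (W2 w) :=
  continuous_iff_continuousAt.2 fun x => (W2_hasDeriv w x).continuousAt

lemma memLp_of_continuous {g : ℝ → ℂ} (hg : Continuous g) : MemLp g 2 μD := by
  obtain ⟨C, hC⟩ := isCompact_Icc.exists_bound_of_continuousOn (s := Icc (0 : ℝ) 1)
    hg.continuousOn
  refine MemLp.of_bound hg.aestronglyMeasurable C ?_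
  exact (ae_restrict_iff' measurableSet_Ioo).2
    (Eventually.of_forall fun x hx => hC x (Ioo_subset_Icc_self hx))

/-- Auxiliary: the iterated primitive as a bounded operator on `L²(0, 1)`. -/
def opK : L2 →L[ℂ] L2 :=
  LinearMap.mkContinuous
    { toFun := fun w => (memLp_of_continuous (W2_continuous w)).toLp (W2 w)
      map_add' := fun w v => by
        rw [← MemLp.toLp_add]
        exact MemLp.toLp_congr _ _ (Eventually.of_forall fun x => W2_add w v x)
      map_smul' := fun c w => by
        rw [RingHom.id_apply, ← MemLp.toLp_const_smul]
        exact MemLp.toLp_congr _ _ (Eventually.of_forall fun x => W2_smul c w x) }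
    1 (fun w => by
      rw [one_mul]
      refine (Lp.norm_le_of_ae_bound (norm_nonneg w) (C := ‖w‖) ?_).trans ?_
      · filter_upwards [MemLp.coeFn_toLp (memLp_of_continuous (W2_continuous w)),
          ae_restrict_mem measurableSet_Ioo] with x hx hx'
        simp only [LinearMap.coe_mk, AddHom.coe_mk]
        rw [hx]
        exact (W2_norm w x hx'.1.le).trans (mul_le_of_le_one_right (norm_nonneg _) hx'.2.le)
      · simp [measureUnivNNReal])

lemma opK_ae (w : L2) : (opK w : ℝ → ℂ) =ᵐ[μD] W2 w :=
  MemLp.coeFn_toLp (memLp_of_continuous (W2_continuous w))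

/-- Auxiliary: the function `x` as an element of `L²(0, 1)`. -/
def coordX : L2 :=
  (memLp_of_continuous Complex.continuous_ofReal).toLp (fun x : ℝ => (x : ℂ))

lemma coordX_ae : (coordX : ℝ → ℂ) =ᵐ[μD] fun x => (x : ℂ) :=
  MemLp.coeFn_toLp (memLp_of_continuous Complex.continuous_ofReal)

lemma IsH2Rep.formula {g dg : ℝ → ℂ} {u w : L2} (h : IsH2Rep g dg u w) {x : ℝ}
    (hx : x ∈ Icc (0 : ℝ) 1) : g x = g 0 + dg 0 * x + W2 w x := by
  have hd : ∀ y ∈ Icc (0 : ℝ) 1, HasDerivWithinAt (fun y : ℝ => g y - (dg 0 * y + W2 w y)) 0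
      (Icc 0 1) y := fun y hy => by
    have h1 := (((Complex.ofRealCLM.hasDerivAt (x := y)).const_mul (dg 0)).add
      (W2_hasDeriv w y)).hasDerivWithinAt (s := Icc 0 1)
    have h2 := (h.hasDeriv y hy).sub h1
    rw [h.deriv_eq y hy, prim_eq w hy] at h2
    convert! h2 using 1
    simp [W]
  have := constant_of_has_deriv_right_zero (fun y hy => (hd y hy).continuousWithinAt)
    (fun y hy => (hd y (Ico_subset_Icc_self hy)).mono_of_mem_nhdsWithin
      (Icc_mem_nhdsGE_of_mem hy)) x hx
  simp [W2] at this
  simp only [W2]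
  linear_combination this

/-- The space `H²⋄ = {u ∈ H²(0, 1) : u(0) = 0}`. Its elements are recorded as the pairs
`(u, u'') ∈ L² × L²`, so that the inner product is `⟨u, v⟩_{L²} + ⟨u'', v''⟩_{L²}`; here `u(0)` is
the value at `0` of the `C¹` representative of `u`. -/
def H2diamond : Submodule ℂ (WithLp 2 (L2 × L2)) where
  carrier := {p | ∃ g dg : ℝ → ℂ, IsH2Rep g dg p.fst p.snd ∧ g 0 = 0}
  zero_mem' := ⟨0, 0, ⟨Lp.coeFn_zero _ _ _, fun x _ =>
    hasDerivWithinAt_const x (Icc (0 : ℝ) 1) (0 : ℂ), fun x hx => by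
      rw [prim_eq _ hx]
      have := W_smul 0 0 x
      simp [W] at this
      simp⟩, rfl⟩
  add_mem' := by
    rintro p r ⟨g, dg, hg, hg0⟩ ⟨k, dk, hk, hk0⟩
    refine ⟨g + k, dg + dk, ⟨(Lp.coeFn_add _ _).trans (hg.ae_eq.add hk.ae_eq),
      fun x hx => (hg.hasDeriv x hx).add (hk.hasDeriv x hx), fun x hx => ?_⟩, by simp [hg0, hk0]⟩
    have := W_add p.snd r.snd x
    simp only [W] at this
    rw [prim_eq _ hx, Pi.add_apply, Pi.add_apply, hg.deriv_eq x hx, hk.deriv_eq x hx,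
      prim_eq _ hx, prim_eq _ hx, WithLp.add_snd, this]
    ring
  smul_mem' := by
    rintro c p ⟨g, dg, hg, hg0⟩
    refine ⟨c • g, c • dg, ⟨(Lp.coeFn_smul _ _).trans (hg.ae_eq.const_smul c),
      fun x hx => (hg.hasDeriv x hx).const_smul c, fun x hx => ?_⟩, by simp [hg0]⟩
    have := W_smul c p.snd x
    simp only [W] at this
    rw [prim_eq _ hx, Pi.smul_apply, Pi.smul_apply, hg.deriv_eq x hx,
      prim_eq _ hx, WithLp.smul_snd, this]
    simp only [smul_eq_mul]
    ring

lemma H2diamond_formula {p : WithLp 2 (L2 × L2)} (hp : p ∈ H2diamond) :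
    ∃ b : ℂ, (p.fst : ℝ → ℂ) =ᵐ[μD] fun x => b * x + W2 p.snd x := by
  obtain ⟨g, dg, hg, hg0⟩ := hp
  refine ⟨dg 0, ?_⟩
  filter_upwards [hg.ae_eq, ae_restrict_mem measurableSet_Ioo] with x hx hx'
  rw [hx, hg.formula (Ioo_subset_Icc_self hx'), hg0, zero_add]

lemma mem_H2diamond_iff (p : WithLp 2 (L2 × L2)) :
    p ∈ H2diamond ↔ p.fst - opK p.snd ∈ Submodule.span ℂ {coordX} := by
  rw [Submodule.mem_span_singleton]
  constructor
  · intro hp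
    obtain ⟨b, hb⟩ := H2diamond_formula hp
    refine ⟨b, Lp.ext ?_⟩
    filter_upwards [hb, Lp.coeFn_smul b coordX, coordX_ae, opK_ae p.snd,
      Lp.coeFn_sub p.fst (opK p.snd)] with x h1 h2 h3 h4 h5
    rw [h2, h5, Pi.smul_apply, Pi.sub_apply, h1, h3, h4, smul_eq_mul]
    ring
  · rintro ⟨b, hb⟩
    refine ⟨fun x => b * x + W2 p.snd x, fun x => b + W p.snd x, ⟨?_, fun x _ => ?_,
      fun x hx => ?_⟩, by simp [W2]⟩
    · have hb' : p.fst = b • coordX + opK p.snd := by rw [hb]; abel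
      filter_upwards [Lp.coeFn_smul b coordX, coordX_ae, opK_ae p.snd,
        Lp.coeFn_add (b • coordX) (opK p.snd)] with x h2 h3 h4 h5
      rw [hb', h5, Pi.add_apply, h2, h4, Pi.smul_apply, h3, smul_eq_mul]
    · have h1 := (((Complex.ofRealCLM.hasDerivAt (x := x)).const_mul b).add
        (W2_hasDeriv p.snd x)).hasDerivWithinAt (s := Icc 0 1)
      convert! h1 using 1
      simp
    · rw [prim_eq _ hx]
      simp [W]

lemma H2diamond_isClosed : IsClosed (H2diamond : Set (WithLp 2 (L2 × L2))) := by
  have h : Continuous fun p : WithLp 2 (L2 × L2) => p.fst - opK p.snd :=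
    (WithLp.continuous_fst 2 L2 L2).sub (opK.continuous.comp (WithLp.continuous_snd 2 L2 L2))
  have h2 := (Submodule.closed_of_finiteDimensional (Submodule.span ℂ {coordX})).preimage h
  convert h2 using 1
  ext p
  exact mem_H2diamond_iff p

instance : CompleteSpace H2diamond := H2diamond_isClosed.completeSpace_coe

/-- The Hilbert space `X⋄ = H²⋄ × L²` with the inner product
`⟨u₁, φ₁⟩_{L²} + ⟨u₁'', φ₁''⟩_{L²} + ⟨u₂, φ₂⟩_{L²}`. -/
abbrev Xdiamond : Type := WithLp 2 (H2diamond × L2)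


lemma linear_ode_exists {E : Type*} [NormedAddCommGroup E] [NormedSpace ℝ E] [CompleteSpace E]
    (A : ℝ → E →L[ℝ] E) (hA : Continuous A) (M : ℝ) (hM : ∀ t, ‖A t‖ ≤ M) (v : E) :
    ∃ Y : ℝ → E, Y 0 = v ∧ ∀ x ∈ Icc (0 : ℝ) 1, HasDerivAt Y (A x (Y x)) x := by
  have hM0 : 0 ≤ M := (norm_nonneg _).trans (hM 0)
  let Y : ℕ → ℝ → E := fun n => Nat.rec (fun _ => v) (fun _ y x => ∫ t in (0 : ℝ)..x, A t (y t)) n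
  have hY0 : ∀ x, Y 0 x = v := fun _ => rfl
  have hYs : ∀ n x, Y (n + 1) x = ∫ t in (0 : ℝ)..x, A t (Y n t) := fun _ _ => rfl
  have hcd : ∀ n, Continuous (Y n) ∧ ∀ x, HasDerivAt (Y (n + 1)) (A x (Y n x)) x := by
    have step : ∀ n, Continuous (Y n) → ∀ x, HasDerivAt (Y (n + 1)) (A x (Y n x)) x :=
      fun n hn x => ((hA.clm_apply hn).integral_hasStrictDerivAt 0 x).hasDerivAt
    intro n
    induction n with
    | zero => exact ⟨continuous_const, step 0 continuous_const⟩
    | succ n ih =>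
      have hc : Continuous (Y (n + 1)) :=
        continuous_iff_continuousAt.2 fun x => (ih.2 x).continuousAt
      exact ⟨hc, step (n + 1) hc⟩
  have hb : ∀ n x, ‖Y n x‖ ≤ ‖v‖ * M ^ n / n.factorial * |x - 0| ^ n := by
    intro n
    induction n with
    | zero => intro x; simp [hY0]
    | succ n ih =>
      intro x
      rw [hYs]
      refine intervalIntegral.norm_integral_le_integral_norm_uIoc.trans ?_
      have h1 : ∫ t in uIoc (0 : ℝ) x, ‖A t (Y n t)‖ ≤
          ∫ t in uIoc (0 : ℝ) x, M * (‖v‖ * M ^ n / n.factorial) * |t - 0| ^ n := by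
        refine setIntegral_mono ?_ ?_ fun t => ?_
        · exact (((hA.clm_apply (hcd n).1).norm).intervalIntegrable 0 x).def'
        · exact ((by fun_prop : Continuous fun t : ℝ =>
            M * (‖v‖ * M ^ n / n.factorial) * |t - 0| ^ n).intervalIntegrable 0 x).def'
        · refine ((A t).le_opNorm _).trans ?_
          rw [mul_assoc]
          exact mul_le_mul (hM t) (ih t) (norm_nonneg _) hM0
      refine h1.trans (le_of_eq ?_)
      rw [integral_const_mul, integral_pow_abs_sub_uIoc, Nat.factorial_succ]
      push_cast
      field_simp
      ring
  have hu : Summable fun n : ℕ => ‖v‖ * (M * 2) ^ n / n.factorial := by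
    simpa [mul_div_assoc] using (Real.summable_pow_div_factorial (M * 2)).mul_left ‖v‖
  have hb2 : ∀ n x, x ∈ Ioo (-2 : ℝ) 2 → ‖Y n x‖ ≤ ‖v‖ * (M * 2) ^ n / n.factorial := by
    intro n x hx
    refine (hb n x).trans ?_
    have : |x - 0| ≤ 2 := by rw [sub_zero, abs_le]; exact ⟨hx.1.le, hx.2.le⟩
    calc ‖v‖ * M ^ n / n.factorial * |x - 0| ^ n ≤ ‖v‖ * M ^ n / n.factorial * 2 ^ n := by gcongr
      _ = ‖v‖ * (M * 2) ^ n / n.factorial := by rw [mul_pow]; ring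
  have hs : ∀ x ∈ Ioo (-2 : ℝ) 2, Summable fun n => Y n x := fun x hx =>
    Summable.of_norm_bounded hu fun n => hb2 n x hx
  have hz : ∀ n, Y (n + 1) 0 = 0 := fun n => by rw [hYs, intervalIntegral.integral_same]
  refine ⟨fun x => v + ∑' n, Y (n + 1) x, by simp [hz], fun x hx => ?_⟩
  have hx2 : x ∈ Ioo (-2 : ℝ) 2 := ⟨by linarith [hx.1], by linarith [hx.2]⟩
  have hd := hasDerivAt_tsum_of_isPreconnected (g := fun n => Y (n + 1))
    (g' := fun n x => A x (Y n x)) (y₀ := 0) (y := x) (hu.mul_left M) isOpen_Ioo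
    isPreconnected_Ioo (fun n y _ => (hcd n).2 y)
    (fun n y hy => ((A y).le_opNorm _).trans
      (mul_le_mul (hM y) (hb2 n y hy) (norm_nonneg _) hM0)) (by norm_num)
    (by simp [hz, summable_zero]) hx2
  have h2 : A x (v + ∑' n, Y (n + 1) x) = ∑' n, A x (Y n x) := by
    rw [← hY0 x, ← (hs x hx2).tsum_eq_zero_add, (A x).map_tsum (hs x hx2)]
  simp only
  rw [h2]
  exact hd.const_add v

/-! ### The coefficient and the initial value problems -/

/-- The coefficient `q ∈ C[0, 1]` as a function on `ℝ` (only its values on `[0, 1]` are used). -/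
def coeff (q : C(Icc (0 : ℝ) 1, ℝ)) : ℝ → ℝ := IccExtend zero_le_one q

/-- `z` solves `z'' + ω² q z = 0` on `[0, 1]` with `z(0) = α` and `z'(0) = β`. -/
def IsIVPSolution (q : C(Icc (0 : ℝ) 1, ℝ)) (ω α β : ℂ) (z : ℝ → ℂ) : Prop :=
  ∃ z' : ℝ → ℂ, z 0 = α ∧ z' 0 = β ∧ ∀ x ∈ Icc (0 : ℝ) 1,
    HasDerivWithinAt z (z' x) (Icc 0 1) x ∧
    HasDerivWithinAt z' (-(ω ^ 2 * coeff q x * z x)) (Icc 0 1) x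

lemma IsIVPSolution.exists (q : C(Icc (0 : ℝ) 1, ℝ)) (ω α β : ℂ) :
    ∃ z, IsIVPSolution q ω α β z := by
  let B₀ : ℂ × ℂ →L[ℝ] ℂ × ℂ :=
    (ContinuousLinearMap.inl ℝ ℂ ℂ).comp (ContinuousLinearMap.snd ℝ ℂ ℂ)
  let B₁ : ℂ × ℂ →L[ℝ] ℂ × ℂ := (ContinuousLinearMap.inr ℝ ℂ ℂ).comp
    ((-(ω ^ 2)) • (ContinuousLinearMap.fst ℝ ℂ ℂ))
  have hq : Continuous (coeff q) := q.continuous.Icc_extend'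
  have hqb : ∀ x, ‖coeff q x‖ ≤ ‖q‖ := fun x => q.norm_coe_le_norm _
  obtain ⟨Y, hY0, hY⟩ := linear_ode_exists (fun t => B₀ + coeff q t • B₁) (by fun_prop)
    (‖B₀‖ + ‖q‖ * ‖B₁‖) (fun t => (norm_add_le _ _).trans (by
      rw [norm_smul]; gcongr; exact hqb t)) (α, β)
  refine ⟨fun x => (Y x).1, fun x => (Y x).2, by simp [hY0], by simp [hY0], fun x hx => ⟨?_, ?_⟩⟩
  · have := (ContinuousLinearMap.fst ℝ ℂ ℂ).hasFDerivAt.comp_hasDerivAt x (hY x hx)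
    convert! this.hasDerivWithinAt using 1
    simp [B₀, B₁]
  · have := (ContinuousLinearMap.snd ℝ ℂ ℂ).hasFDerivAt.comp_hasDerivAt x (hY x hx)
    convert! this.hasDerivWithinAt using 1
    simp [B₀, B₁]
    ring


/-- The solution of `z'' + ω² q z = 0`, `z(0) = α`, `z'(0) = β` (it is unique on `[0, 1]`). -/
def ivpSol (q : C(Icc (0 : ℝ) 1, ℝ)) (ω α β : ℂ) : ℝ → ℂ :=
  (IsIVPSolution.exists q ω α β).choose

lemma ivpSol_spec (q : C(Icc (0 : ℝ) 1, ℝ)) (ω α β : ℂ) :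
    IsIVPSolution q ω α β (ivpSol q ω α β) :=
  (IsIVPSolution.exists q ω α β).choose_spec

/-- `z_ω`: the solution with `z_ω(0) = 0` and derivative `1` at `0`. -/
def zSol (q : C(Icc (0 : ℝ) 1, ℝ)) (ω : ℂ) : ℝ → ℂ := ivpSol q ω 0 1

/-- The companion solution `z̃_ω`, with `z̃_ω(0) = 1` and derivative `0` at `0`. -/
def ztSol (q : C(Icc (0 : ℝ) 1, ℝ)) (ω : ℂ) : ℝ → ℂ := ivpSol q ω 1 0

/-- `a_ω`: the solution of `a'' + ω² q a = f` with zero initial data, by variation of constants. -/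
def aSol (q : C(Icc (0 : ℝ) 1, ℝ)) (f : L2) (ω : ℂ) (x : ℝ) : ℂ :=
  ∫ t in (0 : ℝ)..x, (zSol q ω x * ztSol q ω t - zSol q ω t * ztSol q ω x) * f t

/-- `ζ(ω) = (∫ z_ω a_ω z_{2ω} χ₂ dx/x)² - (∫ z_ω² z_{2ω} χ₂ dx/x) (∫ a_ω² z_{2ω} χ₂ dx/x)`. -/
def zeta (q : C(Icc (0 : ℝ) 1, ℝ)) (χ₂ : Linfty) (f : L2) (ω : ℂ) : ℂ :=
  (∫ x in D, zSol q ω x * aSol q f ω x * zSol q (2 * ω) x * (χ₂ x / x)) ^ 2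
  - (∫ x in D, zSol q ω x ^ 2 * zSol q (2 * ω) x * (χ₂ x / x))
    * ∫ x in D, aSol q f ω x ^ 2 * zSol q (2 * ω) x * (χ₂ x / x)

/-- The set `Λ` of zeros of `ζ`, together with `0`. -/
def Lam (q : C(Icc (0 : ℝ) 1, ℝ)) (χ₂ : Linfty) (f : L2) : Set ℂ :=
  {ω | zeta q χ₂ f ω = 0} ∪ {0}

/-- The set `G_{ρ,δ}` of all `ω` with `|ω| ≤ ρ` and `dist(ω, Λ) ≥ δ`. -/
def setG (q : C(Icc (0 : ℝ) 1, ℝ)) (χ₂ : Linfty) (f : L2) (ρ δ : ℝ) : Set ℂ :=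
  {ω | ‖ω‖ ≤ ρ ∧ δ ≤ Metric.infDist ω (Lam q χ₂ f)}

/-! ### The nonlinear operator -/

lemma coeff_memLp (q : C(Icc (0 : ℝ) 1, ℝ)) : MemLp (fun x => (coeff q x : ℂ)) ⊤ μD :=
  MemLp.of_bound (Complex.continuous_ofReal.comp q.continuous.Icc_extend').aestronglyMeasurable
    ‖q‖ (Eventually.of_forall fun x => by
      simpa [coeff, IccExtend] using q.norm_coe_le_norm (projIcc 0 1 zero_le_one x))

lemma H2diamond_div_memLp (u : H2diamond) :
    MemLp (fun x : ℝ => (u : WithLp 2 (L2 × L2)).fst x / x) ⊤ μD := by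
  obtain ⟨b, hb⟩ := H2diamond_formula u.2
  refine MemLp.of_bound ((Lp.aestronglyMeasurable _).div₀
    Complex.continuous_ofReal.aestronglyMeasurable)
    (‖b‖ + ‖(u : WithLp 2 (L2 × L2)).snd‖) ?_
  filter_upwards [hb, ae_restrict_mem measurableSet_Ioo] with x hx hx'
  rw [norm_div, hx, Complex.norm_real, Real.norm_of_nonneg hx'.1.le, div_le_iff₀ hx'.1, add_mul]
  refine (norm_add_le _ _).trans (add_le_add ?_ (W2_norm _ x hx'.1.le))
  rw [norm_mul, Complex.norm_real, Real.norm_of_nonneg hx'.1.le]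

namespace Xdiamond

/-- The first component `u₁` of an element of `X⋄`. -/
def u₁ (u : Xdiamond) : ℝ → ℂ := (u.fst : WithLp 2 (L2 × L2)).fst
/-- The second derivative `u₁''` of the first component of an element of `X⋄`. -/
def d2u₁ (u : Xdiamond) : ℝ → ℂ := (u.fst : WithLp 2 (L2 × L2)).snd
/-- The second component `u₂` of an element of `X⋄`. -/
def u₂ (u : Xdiamond) : ℝ → ℂ := u.snd

end Xdiamond

/-- The form `𝒯⋄_ω(u, φ)`, where for `u = (u₁, u₂)` and `φ = (φ₁, φ₂)` in `X⋄`
`𝒯⋄_ω(u, φ) = ∫ [(u₁'' + ω² q u₁) φ̄₂ + (ω²/x) χ₁ u₂ ū₁ φ̄₂]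
  + ∫ [u₂ (φ̄₁'' + 4 ω² q φ̄₁) + (ω²/x) χ₂ u₁² φ̄₁]`. -/
def formT (q : C(Icc (0 : ℝ) 1, ℝ)) (χ₁ χ₂ : Linfty) (ω : ℂ) (u φ : Xdiamond) : ℂ :=
  (∫ x in D, ((u.d2u₁ x + ω ^ 2 * coeff q x * u.u₁ x) * conj (φ.u₂ x)
      + ω ^ 2 / x * χ₁ x * u.u₂ x * conj (u.u₁ x) * conj (φ.u₂ x)))
  + ∫ x in D, (u.u₂ x * (conj (φ.d2u₁ x) + 4 * ω ^ 2 * coeff q x * conj (φ.u₁ x))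
      + ω ^ 2 / x * χ₂ x * u.u₁ x ^ 2 * conj (φ.u₁ x))

theorem formT_representable (q : C(Icc (0 : ℝ) 1, ℝ)) (χ₁ χ₂ : Linfty) (ω : ℂ) (u : Xdiamond) :
    ∃ t : Xdiamond, ∀ φ : Xdiamond, formT q χ₁ χ₂ ω u φ = inner ℂ φ t := by
  have hq := coeff_memLp q
  have hu1 : MemLp u.u₁ 2 μD := Lp.memLp _
  have hd2 : MemLp u.d2u₁ 2 μD := Lp.memLp _
  have hu2 : MemLp u.u₂ 2 μD := Lp.memLp _
  have hx : MemLp (fun x : ℝ => u.u₁ x / x) ⊤ μD := H2diamond_div_memLp u.fst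
  have hxc : MemLp (fun x : ℝ => conj (u.u₁ x / x)) ⊤ μD := hx.star
  have h1a : MemLp (fun x => (coeff q x : ℂ) * u.u₁ x) 2 μD := hu1.mul' hq
  have h1b : MemLp (fun x => conj (u.u₁ x / x) * u.u₂ x) 2 μD := hu2.mul' hxc
  have h1c : MemLp (fun x => χ₁ x * (conj (u.u₁ x / x) * u.u₂ x)) 2 μD :=
    h1b.mul' (Lp.memLp χ₁)
  have h1 : MemLp (fun x => u.d2u₁ x + ω ^ 2 * (coeff q x * u.u₁ x)
      + ω ^ 2 * (χ₁ x * (conj (u.u₁ x / x) * u.u₂ x))) 2 μD :=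
    (hd2.add (h1a.const_mul _)).add (h1c.const_mul _)
  have h2a : MemLp (fun x => (coeff q x : ℂ) * u.u₂ x) 2 μD := hu2.mul' hq
  have h2b : MemLp (fun x => (u.u₁ x / x) * u.u₁ x) 2 μD := hu1.mul' hx
  have h2c : MemLp (fun x => χ₂ x * ((u.u₁ x / x) * u.u₁ x)) 2 μD := h2b.mul' (Lp.memLp χ₂)
  have h2 : MemLp (fun x => 4 * ω ^ 2 * (coeff q x * u.u₂ x)
      + ω ^ 2 * (χ₂ x * ((u.u₁ x / x) * u.u₁ x))) 2 μD :=
    (h2a.const_mul _).add (h2c.const_mul _)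
  let P : WithLp 2 (L2 × L2) := WithLp.toLp 2 (h2.toLp _, u.snd)
  refine ⟨WithLp.toLp 2 (H2diamond.orthogonalProjectionOnto P, h1.toLp _), fun φ => ?_⟩
  rw [WithLp.prod_inner_apply, Submodule.inner_orthogonalProjectionOnto_eq_of_mem_left,
    WithLp.prod_inner_apply, add_comm]
  simp only [L2.inner_def]
  rw [← integral_add (L2.integrable_inner _ _) (L2.integrable_inner _ _)]
  unfold formT
  congr 1
  · apply integral_congr_ae
    filter_upwards [h1.coeFn_toLp] with x hx1
    rw [hx1, RCLike.inner_apply, map_div₀, Complex.conj_ofReal]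
    simp only [Xdiamond.u₂, WithLp.ofLp_snd]
    ring
  · apply integral_congr_ae
    filter_upwards [h2.coeFn_toLp] with x hx2
    simp only [P, RCLike.inner_apply]
    rw [hx2]
    simp only [Xdiamond.u₂, Xdiamond.u₁, Xdiamond.d2u₁, WithLp.ofLp_snd, WithLp.ofLp_fst]
    ring

theorem formT_existsUnique (q : C(Icc (0 : ℝ) 1, ℝ)) (χ₁ χ₂ : Linfty) (ω : ℂ) (u : Xdiamond) :
    ∃! t : Xdiamond, ∀ φ : Xdiamond, formT q χ₁ χ₂ ω u φ = inner ℂ φ t := by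
  obtain ⟨t, ht⟩ := formT_representable q χ₁ χ₂ ω u
  exact ⟨t, ht, fun s hs => ext_inner_left ℂ fun φ => by rw [← hs, ht]⟩

/-- The operator `T⋄_ω : X⋄ → X⋄`: `T⋄_ω(u)` is the unique element of `X⋄` that represents the
conjugate linear functional `φ ↦ 𝒯⋄_ω(u, φ)`. (The inner product here is conjugate linear in its
first argument.) -/
def Tdiamond (q : C(Icc (0 : ℝ) 1, ℝ)) (χ₁ χ₂ : Linfty) (ω : ℂ) (u : Xdiamond) : Xdiamond :=
  (formT_existsUnique q χ₁ χ₂ ω u).choose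

lemma inner_Tdiamond (q : C(Icc (0 : ℝ) 1, ℝ)) (χ₁ χ₂ : Linfty) (ω : ℂ) (u φ : Xdiamond) :
    formT q χ₁ χ₂ ω u φ = inner ℂ φ (Tdiamond q χ₁ χ₂ ω u) :=
  (formT_existsUnique q χ₁ χ₂ ω u).choose_spec.1 φ

/-- The element `(0, f)` of `X⋄`. -/
def source (f : L2) : Xdiamond := WithLp.toLp 2 (0, f)

end RadialSHG

end

noncomputable section

namespace RadialSHG

/-! ### Calculus on `[0, 1]` -/

/-! Write `L_ω u = u'' + ω² q u` on `H²⋄`. In strong form (`Tdiamond_eq`) the operator has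
components `L_{2ω̄}* u₂ + ω² E*(χ₂ u₁²/x)` and `L_ω u₁ + ω² χ₁ ū₁ u₂/x`, with `E : H²⋄ → L²` the
embedding. At `χ₁ = 0` the system is triangular: first `L_ω u₁ = f`, then a linear equation for
`u₂`.

No condition is imposed at `x = 1`, so `L_ω` is onto `L²` (`exists_opL_eq_aSol`) with kernel spanned
by `z_ω` (`eq_smul_of_opL_eq_zero`); hence `u₁ = a_ω + t z_ω` with `t` free. By `exists_adjoint_eq`
the equation for `u₂` is solvable iff its right-hand side is orthogonal to the kernel of `L_{2ω̄}`.
As `q` is real, this reads `∫ u₁² z_{2ω} χ₂ dx/x = 0`, a polynomial equation in `t` of degree at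
most two, whose discriminant is `4 ζ(ω)`. If `ζ(ω) ≠ 0` it has a simple root (`exists_root`).

Simplicity means `∫ u₁ z_ω z_{2ω} χ₂ dx/x ≠ 0`. Together with `ω ≠ 0` this makes the linearization
at that solution onto (`exists_linearized_eq`): moving `u₁` along `z_ω` corrects the one-dimensional
obstruction. The map is `C¹` over `ℝ`, jointly in `χ₁`, `ω` and the unknowns, so
`eventually_exists_eq` gives solutions for all parameters near `(0, ω)`. Compactness of `G_{ρ,δ}`
then makes the smallness of `χ₁` uniform in `ω`. -/

lemma hasDerivWithinAt_primitive {φ : ℝ → ℂ} (hφ : ContinuousOn φ (Icc 0 1)) {x : ℝ}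
    (hx : x ∈ Icc (0 : ℝ) 1) :
    HasDerivWithinAt (fun y => ∫ t in (0 : ℝ)..y, φ t) (φ x) (Icc 0 1) x := by
  -- Constant extension beyond the endpoints gives a function continuous on all of `ℝ`, with the
  -- same primitive on `[0, 1]`.
  set ψ : ℝ → ℂ := IccExtend zero_le_one ((Icc (0 : ℝ) 1).domRestrict φ) with hψ
  have hc : Continuous ψ := (continuousOn_iff_continuous_domRestrict.1 hφ).Icc_extend'
  have he : ∀ y ∈ Icc (0 : ℝ) 1, ψ y = φ y := fun y hy => by
    rw [hψ, IccExtend_of_mem _ _ hy, domRestrict_apply]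
  have h := (hc.integral_hasStrictDerivAt 0 x).hasDerivAt.hasDerivWithinAt (s := Icc (0 : ℝ) 1)
  rw [he x hx] at h
  refine h.congr_of_mem (fun y hy => ?_) hx
  refine intervalIntegral.integral_congr fun t ht => ?_
  rw [uIcc_of_le hy.1] at ht
  exact (he t ⟨ht.1, ht.2.trans hy.2⟩).symm

lemma eq_of_hasDerivWithinAt_zero {h : ℝ → ℂ}
    (hd : ∀ x ∈ Icc (0 : ℝ) 1, HasDerivWithinAt h 0 (Icc 0 1) x) {x : ℝ}
    (hx : x ∈ Icc (0 : ℝ) 1) : h x = h 0 :=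
  constant_of_has_deriv_right_zero (fun y hy => (hd y hy).continuousWithinAt)
    (fun y hy => (hd y (Ico_subset_Icc_self hy)).mono_of_mem_nhdsWithin
      (Icc_mem_nhdsGE_of_mem hy)) x hx

lemma integral_eq_of_hasDerivWithinAt {h h' : ℝ → ℂ}
    (hd : ∀ x ∈ Icc (0 : ℝ) 1, HasDerivWithinAt h (h' x) (Icc 0 1) x)
    (hc : ContinuousOn h' (Icc 0 1)) {x : ℝ} (hx : x ∈ Icc (0 : ℝ) 1) :
    h x = h 0 + ∫ t in (0 : ℝ)..x, h' t := by
  have := eq_of_hasDerivWithinAt_zero (h := fun y => h y - ∫ t in (0 : ℝ)..y, h' t)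
    (fun y hy => by
      convert! (hd y hy).sub (hasDerivWithinAt_primitive hc hy) using 1
      simp) hx
  simp only [intervalIntegral.integral_same, sub_zero] at this
  linear_combination this

lemma L2.intervalIntegrable (g : L2) {x : ℝ} (hx : x ∈ Icc (0 : ℝ) 1) :
    IntervalIntegrable g volume 0 x := by
  rw [intervalIntegrable_iff_integrableOn_Ioo_of_le hx.1]
  exact IntegrableOn.mono_set (L2.integrable g) (Ioo_subset_Ioo_right hx.2)

lemma W_eq (g : L2) {x : ℝ} (hx : x ∈ Icc (0 : ℝ) 1) : W g x = ∫ t in (0 : ℝ)..x, g t :=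
  (prim_eq g hx).symm

/-- Integration by parts of a `C¹` function against an `L²` function. -/
lemma integral_mul_L2 {φ φ' : ℝ → ℂ}
    (hφ : ∀ x ∈ Icc (0 : ℝ) 1, HasDerivWithinAt φ (φ' x) (Icc 0 1) x)
    (hφ' : ContinuousOn φ' (Icc 0 1)) (g : L2) {x : ℝ} (hx : x ∈ Icc (0 : ℝ) 1) :
    ∫ t in (0 : ℝ)..x, φ t * g t = φ x * W g x - ∫ t in (0 : ℝ)..x, φ' t * W g t := by
  have hsub : Icc 0 x ⊆ Icc (0 : ℝ) 1 := Icc_subset_Icc_right hx.2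
  have hgi : IntegrableOn g (Ioc 0 x) := (L2.intervalIntegrable g hx).1
  have hφi : IntegrableOn φ' (Ioc 0 x) :=
    ((hφ'.mono hsub).integrableOn_Icc).mono_set Ioc_subset_Icc_self
  set ν : Measure ℝ := volume.restrict (Ioc 0 x) with hν
  -- The integration by parts is Fubini for `g(t) φ'(s)` on the triangle `t < s`: the inner
  -- `s`-integral is `(φ(x) - φ(t)) g(t)`, the inner `t`-integral is `φ'(s) W(s)`.
  have hK : Integrable (fun p : ℝ × ℝ => {p : ℝ × ℝ | p.1 < p.2}.indicator
      (fun p => g p.1 * φ' p.2) p) (ν.prod ν) :=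
    (Integrable.mul_prod hgi hφi).indicator (measurableSet_lt measurable_fst measurable_snd)
  have hswap := integral_integral_swap (f := fun t s => {p : ℝ × ℝ | p.1 < p.2}.indicator
      (fun p => g p.1 * φ' p.2) (t, s)) hK
  have h1 : ∀ t ∈ Ioc 0 x, ∫ s, {p : ℝ × ℝ | p.1 < p.2}.indicator
      (fun p => g p.1 * φ' p.2) (t, s) ∂ν = φ x * g t - φ t * g t := fun t ht => by
    have ht1 : t ∈ Icc (0 : ℝ) 1 := hsub ⟨ht.1.le, ht.2⟩
    have e : (fun s => {p : ℝ × ℝ | p.1 < p.2}.indicator (fun p => g p.1 * φ' p.2) (t, s))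
        = (Ioi t).indicator (fun s => g t * φ' s) := by
      ext s; simp [indicator]
    rw [e, integral_indicator measurableSet_Ioi, hν, Measure.restrict_restrict measurableSet_Ioi]
    have : Ioi t ∩ Ioc 0 x = Ioc t x := by
      ext s; simp only [mem_inter_iff, mem_Ioi, mem_Ioc]
      constructor
      · rintro ⟨a, b, c⟩; exact ⟨a, c⟩
      · rintro ⟨a, c⟩; exact ⟨a, ht.1.trans a, c⟩
    rw [this, integral_const_mul, ← intervalIntegral.integral_of_le ht.2,
      ← intervalIntegral.integral_interval_sub_left (a := 0),
      integral_eq_of_hasDerivWithinAt hφ hφ' hx, integral_eq_of_hasDerivWithinAt hφ hφ' ht1]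
    · ring
    · exact ((hφ'.mono hsub).intervalIntegrable_of_Icc hx.1)
    · exact ((hφ'.mono (Icc_subset_Icc_right ht1.2)).intervalIntegrable_of_Icc ht1.1)
  have h2 : ∀ s ∈ Ioc 0 x, ∫ t, {p : ℝ × ℝ | p.1 < p.2}.indicator
      (fun p => g p.1 * φ' p.2) (t, s) ∂ν = φ' s * W g s := fun s hs => by
    have e : (fun t => {p : ℝ × ℝ | p.1 < p.2}.indicator (fun p => g p.1 * φ' p.2) (t, s))
        = (Iio s).indicator (fun t => g t * φ' s) := by
      ext t; simp [indicator]
    rw [e, integral_indicator measurableSet_Iio, hν, Measure.restrict_restrict measurableSet_Iio]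
    have : Iio s ∩ Ioc 0 x = Ioo 0 s := by
      ext t; simp only [mem_inter_iff, mem_Iio, mem_Ioc, mem_Ioo]
      constructor
      · rintro ⟨a, b, c⟩; exact ⟨b, a⟩
      · rintro ⟨b, a⟩; exact ⟨a, b, a.le.trans hs.2⟩
    rw [this, integral_mul_const, ← integral_Ioc_eq_integral_Ioo,
      ← intervalIntegral.integral_of_le hs.1.le, ← W_eq g (hsub ⟨hs.1.le, hs.2⟩), mul_comm]
  rw [setIntegral_congr_fun measurableSet_Ioc h1, setIntegral_congr_fun measurableSet_Ioc h2,
    ← intervalIntegral.integral_of_le hx.1, ← intervalIntegral.integral_of_le hx.1,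
    intervalIntegral.integral_sub, intervalIntegral.integral_const_mul, ← W_eq g hx] at hswap
  · linear_combination -hswap
  · exact (L2.intervalIntegrable g hx).const_mul _
  · refine (L2.intervalIntegrable g hx).continuousOn_mul ?_
    rw [uIcc_of_le hx.1]
    exact fun t ht => ((hφ t (hsub ht)).continuousWithinAt).mono hsub

/-! ### The fundamental system of `z'' + ω² q z = 0` -/

/-- The equation has no first-order term, so the derivative of the Wronskian cancels. -/
lemma wronskian_eq {p u u' v v' : ℝ → ℂ}
    (hu : ∀ x ∈ Icc (0 : ℝ) 1, HasDerivWithinAt u (u' x) (Icc 0 1) x ∧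
      HasDerivWithinAt u' (-(p x * u x)) (Icc 0 1) x)
    (hv : ∀ x ∈ Icc (0 : ℝ) 1, HasDerivWithinAt v (v' x) (Icc 0 1) x ∧
      HasDerivWithinAt v' (-(p x * v x)) (Icc 0 1) x) {x : ℝ} (hx : x ∈ Icc (0 : ℝ) 1) :
    u x * v' x - u' x * v x = u 0 * v' 0 - u' 0 * v 0 :=
  eq_of_hasDerivWithinAt_zero (h := fun x => u x * v' x - u' x * v x) (fun y hy => by
    convert! ((hu y hy).1.mul (hv y hy).2).sub ((hu y hy).2.mul (hv y hy).1) using 1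
    ring) hx

/-- The three constant Wronskians of `u`, `z_ω`, `z̃_ω` determine `u` by Cramer's rule. This also
yields uniqueness for the initial value problem. -/
lemma IsIVPSolution.eq_combination {q : C(Icc (0 : ℝ) 1, ℝ)} {ω α β : ℂ} {u : ℝ → ℂ}
    (h : IsIVPSolution q ω α β u) {x : ℝ} (hx : x ∈ Icc (0 : ℝ) 1) :
    u x = α * ztSol q ω x + β * zSol q ω x := by
  obtain ⟨u', hu0, hu0', hu⟩ := h
  obtain ⟨z', hz0, hz0', hz⟩ := ivpSol_spec q ω 0 1
  obtain ⟨y', hy0, hy0', hy⟩ := ivpSol_spec q ω 1 0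
  have h1 := wronskian_eq (p := fun x => ω ^ 2 * coeff q x) hu hz hx
  have h2 := wronskian_eq (p := fun x => ω ^ 2 * coeff q x) hu hy hx
  have h3 := wronskian_eq (p := fun x => ω ^ 2 * coeff q x) hy hz hx
  rw [hz0, hz0', hu0, hu0'] at h1
  rw [hy0, hy0', hu0, hu0'] at h2
  rw [hz0, hz0', hy0, hy0'] at h3
  unfold zSol ztSol
  linear_combination ivpSol q ω 1 0 x * h1 - ivpSol q ω 0 1 x * h2 - u x * h3

/-- Because `q` is real, conjugation carries the problem at `ω` to the problem at `ω̄`. This turns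
an inner product against the kernel of `L_{2ω̄}` into a bilinear integral against `z_{2ω}`. -/
lemma conj_zSol (q : C(Icc (0 : ℝ) 1, ℝ)) (ω : ℂ) {x : ℝ} (hx : x ∈ Icc (0 : ℝ) 1) :
    conj (zSol q ω x) = zSol q (conj ω) x := by
  obtain ⟨z', hz0, hz0', hz⟩ := ivpSol_spec q ω 0 1
  have h : IsIVPSolution q (conj ω) 0 1 (fun x => conj (zSol q ω x)) := by
    refine ⟨fun x => conj (z' x), ?_, ?_, fun y hy => ⟨?_, ?_⟩⟩
    · simp [zSol, hz0]
    · simp [hz0']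
    · exact Complex.conjCLE.toContinuousLinearMap.hasFDerivAt.comp_hasDerivWithinAt y (hz y hy).1
    · have := Complex.conjCLE.toContinuousLinearMap.hasFDerivAt.comp_hasDerivWithinAt y (hz y hy).2
      convert! this using 1
      simp [zSol]
  simpa using h.eq_combination hx

/-- Since `g` is only in `L²`, the derivative of `a_ω` need not be differentiable at every point.
Subtracting the primitive `W g` leaves a `C¹` function, so `a'' + ω² q a = g` can be stated
pointwise. -/
lemma aSol_hasDeriv (q : C(Icc (0 : ℝ) 1, ℝ)) (g : L2) (ω : ℂ) :
    ∃ da : ℝ → ℂ, ∀ x ∈ Icc (0 : ℝ) 1, HasDerivWithinAt (aSol q g ω) (da x) (Icc 0 1) x ∧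
      HasDerivWithinAt (fun y => da y - W g y) (-(ω ^ 2 * coeff q x * aSol q g ω x))
        (Icc 0 1) x := by
  obtain ⟨z', hz0, hz0', hz⟩ := ivpSol_spec q ω 0 1
  obtain ⟨y', hy0, hy0', hy⟩ := ivpSol_spec q ω 1 0
  change ∀ x ∈ Icc (0 : ℝ) 1, HasDerivWithinAt (zSol q ω) _ _ _ ∧ _ at hz
  change ∀ x ∈ Icc (0 : ℝ) 1, HasDerivWithinAt (ztSol q ω) _ _ _ ∧ _ at hy
  change ∀ x ∈ Icc (0 : ℝ) 1, _ ∧ HasDerivWithinAt _ (-(_ * zSol q ω x)) _ _ at hz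
  change ∀ x ∈ Icc (0 : ℝ) 1, _ ∧ HasDerivWithinAt _ (-(_ * ztSol q ω x)) _ _ at hy
  change zSol q ω 0 = 0 at hz0
  change ztSol q ω 0 = 1 at hy0
  set z := zSol q ω
  set y := ztSol q ω
  have hW := (W_continuous g).continuousOn (s := Icc (0 : ℝ) 1)
  have hz'c : ContinuousOn z' (Icc 0 1) := fun x hx => (hz x hx).2.continuousWithinAt
  have hy'c : ContinuousOn y' (Icc 0 1) := fun x hx => (hy x hx).2.continuousWithinAt
  have hwr : ∀ x ∈ Icc (0 : ℝ) 1, y x * z' x - y' x * z x = 1 := fun x hx => by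
    have := wronskian_eq (p := fun x => ω ^ 2 * coeff q x) hy hz hx
    rw [hz0, hz0', hy0, hy0'] at this
    simpa using this
  -- Integration by parts replaces `g` by its continuous primitive; the boundary terms `z y W`
  -- cancel. The term `W g x` in the derivative chosen below then comes from the Wronskian being
  -- `1`.
  have ha : ∀ x ∈ Icc (0 : ℝ) 1, aSol q g ω x =
      y x * (∫ t in (0 : ℝ)..x, z' t * W g t) - z x * ∫ t in (0 : ℝ)..x, y' t * W g t := by
    intro x hx
    have hsub : uIcc 0 x ⊆ Icc (0 : ℝ) 1 := by
      rw [uIcc_of_le hx.1]; exact Icc_subset_Icc_right hx.2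
    have i1 : IntervalIntegrable (fun t => y t * g t) volume 0 x :=
      (L2.intervalIntegrable g hx).continuousOn_mul
        fun t ht => ((hy t (hsub ht)).1.continuousWithinAt).mono hsub
    have i2 : IntervalIntegrable (fun t => z t * g t) volume 0 x :=
      (L2.intervalIntegrable g hx).continuousOn_mul
        fun t ht => ((hz t (hsub ht)).1.continuousWithinAt).mono hsub
    have e : aSol q g ω x = ∫ t in (0 : ℝ)..x, (z x * (y t * g t) - y x * (z t * g t)) := by
      refine intervalIntegral.integral_congr fun t _ => ?_
      ring
    rw [e, intervalIntegral.integral_sub (i1.const_mul _) (i2.const_mul _),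
      intervalIntegral.integral_const_mul, intervalIntegral.integral_const_mul,
      integral_mul_L2 (fun t ht => (hy t ht).1) hy'c g hx,
      integral_mul_L2 (fun t ht => (hz t ht).1) hz'c g hx]
    ring
  have hI := fun x hx => hasDerivWithinAt_primitive (hz'c.mul hW) (x := x) hx
  have hK := fun x hx => hasDerivWithinAt_primitive (hy'c.mul hW) (x := x) hx
  refine ⟨fun x => y' x * (∫ t in (0 : ℝ)..x, z' t * W g t)
    - z' x * (∫ t in (0 : ℝ)..x, y' t * W g t) + W g x, fun x hx => ⟨?_, ?_⟩⟩
  · refine HasDerivWithinAt.congr_of_mem ?_ ha hx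
    convert! ((hy x hx).1.mul (hI x hx)).sub ((hz x hx).1.mul (hK x hx)) using 1
    simp only [Pi.mul_apply]
    linear_combination -W g x * hwr x hx
  · simp only [add_sub_cancel_right]
    rw [ha x hx]
    convert! ((hy x hx).2.mul (hI x hx)).sub ((hz x hx).2.mul (hK x hx)) using 1
    simp only [Pi.mul_apply]
    ring

/-! ### The bounded operators behind `T⋄_ω` -/

/-- The embedding `H²⋄ → L²`. -/
def opE : H2diamond →L[ℂ] L2 := (WithLp.fstL 2 ℂ L2 L2).comp H2diamond.subtypeL

/-- The second derivative `H²⋄ → L²`. -/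
def opD : H2diamond →L[ℂ] L2 := (WithLp.sndL 2 ℂ L2 L2).comp H2diamond.subtypeL

lemma opE_apply (u : H2diamond) : opE u = (u : WithLp 2 (L2 × L2)).fst := rfl

lemma opD_apply (u : H2diamond) : opD u = (u : WithLp 2 (L2 × L2)).snd := rfl

lemma H2diamond_ext {u v : H2diamond} (hE : opE u = opE v) (hD : opD u = opD v) : u = v :=
  Subtype.ext (WithLp.ofLp_injective 2 (Prod.ext hE hD))

/-- Multiplication `L^∞ × L² → L²`. -/
def mulL : Linfty →L[ℂ] L2 →L[ℂ] L2 := (ContinuousLinearMap.mul ℂ ℂ).holderL μD ⊤ 2 2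

lemma mulL_ae (a : Linfty) (v : L2) : (mulL a v : ℝ → ℂ) =ᵐ[μD] fun x => a x * v x :=
  (ContinuousLinearMap.mul ℂ ℂ).coeFn_holder a v

/-- Complex conjugation on `L^∞`. -/
def conjL : Linfty →L[ℝ] Linfty := Complex.conjCLE.toContinuousLinearMap.compLpL ⊤ μD

lemma conjL_ae (a : Linfty) : (conjL a : ℝ → ℂ) =ᵐ[μD] fun x => conj (a x) :=
  ContinuousLinearMap.coeFn_compLpL _ a

/-- The coefficient `q` as an element of `L^∞`. -/
def coeffL (q : C(Icc (0 : ℝ) 1, ℝ)) : Linfty := (coeff_memLp q).toLp _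

lemma coeffL_ae (q : C(Icc (0 : ℝ) 1, ℝ)) :
    (coeffL q : ℝ → ℂ) =ᵐ[μD] fun x => (coeff q x : ℂ) := (coeff_memLp q).coeFn_toLp

lemma coordX_ne_zero : coordX ≠ 0 := by
  intro h
  have h1 := coordX_ae
  rw [h] at h1
  have h2 : ∀ᵐ x ∂μD, False := by
    filter_upwards [h1, Lp.coeFn_zero ℂ 2 μD, ae_restrict_mem measurableSet_Ioo] with x a b c
    rw [b] at a
    exact c.1.ne' (by simpa using a.symm)
  exact h2.exists.elim fun _ h => h

lemma H2diamond_div_norm (u : H2diamond) : ‖(H2diamond_div_memLp u).toLp _‖ ≤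
    (‖coordX‖⁻¹ * (‖opE‖ + ‖opK‖ * ‖opD‖) + ‖opD‖) * ‖u‖ := by
  obtain ⟨b, hb⟩ := H2diamond_formula u.2
  -- The slope at `0` is controlled by the norm of `u` through `b x = u - K u''`, and `|u(x)|/x ≤
  -- |b| + ‖u''‖`.
  have hc : b • coordX = opE u - opK (opD u) := by
    refine Lp.ext ?_
    filter_upwards [hb, Lp.coeFn_smul b coordX, coordX_ae, opK_ae (opD u),
      Lp.coeFn_sub (opE u) (opK (opD u))] with x h1 h2 h3 h4 h5
    rw [h2, h5, Pi.smul_apply, Pi.sub_apply, opE_apply, h1, h3, h4, smul_eq_mul, opD_apply]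
    ring
  have hX : 0 < ‖coordX‖ := norm_pos_iff.2 coordX_ne_zero
  have hbn : ‖b‖ ≤ ‖coordX‖⁻¹ * (‖opE‖ + ‖opK‖ * ‖opD‖) * ‖u‖ := by
    rw [mul_assoc, inv_mul_eq_div, le_div_iff₀ hX, ← norm_smul, hc, add_mul, mul_assoc]
    refine (norm_sub_le _ _).trans (add_le_add (opE.le_opNorm u) ((opK.le_opNorm _).trans ?_))
    gcongr
    exact opD.le_opNorm u
  refine (Lp.norm_le_of_ae_bound (C := ‖b‖ + ‖opD u‖) (by positivity) ?_).trans ?_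
  · filter_upwards [hb, (H2diamond_div_memLp u).coeFn_toLp,
      ae_restrict_mem measurableSet_Ioo] with x hx h2 hx'
    rw [h2, norm_div, hx, Complex.norm_real, Real.norm_of_nonneg hx'.1.le, div_le_iff₀ hx'.1,
      add_mul]
    refine (norm_add_le _ _).trans (add_le_add ?_ (W2_norm _ x hx'.1.le))
    rw [norm_mul, Complex.norm_real, Real.norm_of_nonneg hx'.1.le]
  · simp only [ENNReal.toReal_top, inv_zero, Real.rpow_zero, one_mul]
    rw [add_mul]
    exact add_le_add hbn (opD.le_opNorm u)

/-- The division by `x`, as a bounded operator `H²⋄ → L^∞`. -/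
def opJ : H2diamond →L[ℂ] Linfty :=
  LinearMap.mkContinuous
    { toFun := fun u => (H2diamond_div_memLp u).toLp _
      map_add' := fun u v => by
        rw [← MemLp.toLp_add]
        refine MemLp.toLp_congr _ _ ?_
        filter_upwards [Lp.coeFn_add (opE u) (opE v)] with x hx
        change (opE u + opE v : L2) x / x = opE u x / x + opE v x / x
        rw [hx, Pi.add_apply, add_div]
      map_smul' := fun c u => by
        rw [RingHom.id_apply, ← MemLp.toLp_const_smul]
        refine MemLp.toLp_congr _ _ ?_
        filter_upwards [Lp.coeFn_smul c (opE u)] with x hx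
        change (c • opE u : L2) x / x = c * (opE u x / x)
        rw [hx, Pi.smul_apply, smul_eq_mul, mul_div_assoc] }
    (‖coordX‖⁻¹ * (‖opE‖ + ‖opK‖ * ‖opD‖) + ‖opD‖) H2diamond_div_norm

lemma opJ_ae (u : H2diamond) : (opJ u : ℝ → ℂ) =ᵐ[μD] fun x => opE u x / x :=
  (H2diamond_div_memLp u).coeFn_toLp

/-- The multiplication by `q`, from `H²⋄` to `L²`. -/
def opQ (q : C(Icc (0 : ℝ) 1, ℝ)) : H2diamond →L[ℂ] L2 := (mulL (coeffL q)).comp opE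

lemma opQ_ae (q : C(Icc (0 : ℝ) 1, ℝ)) (u : H2diamond) :
    (opQ q u : ℝ → ℂ) =ᵐ[μD] fun x => coeff q x * opE u x := by
  filter_upwards [mulL_ae (coeffL q) (opE u), coeffL_ae q] with x h1 h2
  rw [← h2, ← h1]; rfl

/-- The operator `u ↦ u'' + ω² q u`. -/
def opL (q : C(Icc (0 : ℝ) 1, ℝ)) (ω : ℂ) : H2diamond →L[ℂ] L2 := opD + ω ^ 2 • opQ q

/-- The quadratic nonlinearity `(u, v) ↦ χ u v / x`. -/
def bil (χ : Linfty) (u v : H2diamond) : L2 := mulL χ (mulL (opJ u) (opE v))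

lemma bil_ae (χ : Linfty) (u v : H2diamond) :
    (bil χ u v : ℝ → ℂ) =ᵐ[μD] fun x => opE u x * opE v x * (χ x / x) := by
  filter_upwards [mulL_ae χ (mulL (opJ u) (opE v)), mulL_ae (opJ u) (opE v), opJ_ae u]
    with x h1 h2 h3
  rw [bil, h1, h2, h3]; ring

lemma bil_comm (χ : Linfty) (u v : H2diamond) : bil χ u v = bil χ v u := by
  refine Lp.ext ?_
  filter_upwards [bil_ae χ u v, bil_ae χ v u] with x h1 h2
  rw [h1, h2]; ring

/-! ### The operator `L_ω` -/

/-- Passage from pointwise solutions to elements of `H²⋄`: the weak second derivative is read off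
from the equation as `g - ω² q h`. It serves both `a_ω` and `z_ω`. -/
lemma exists_opL_eq {q : C(Icc (0 : ℝ) 1, ℝ)} {ω : ℂ} {h dh : ℝ → ℂ} (g : L2) (h0 : h 0 = 0)
    (hd : ∀ x ∈ Icc (0 : ℝ) 1, HasDerivWithinAt h (dh x) (Icc 0 1) x ∧
      HasDerivWithinAt (fun y => dh y - W g y) (-(ω ^ 2 * coeff q x * h x)) (Icc 0 1) x) :
    ∃ u : H2diamond, (opE u : ℝ → ℂ) =ᵐ[μD] h ∧ opL q ω u = g := by
  have hc : ContinuousOn h (Icc 0 1) := fun x hx => (hd x hx).1.continuousWithinAt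
  have hq : Continuous (coeff q) := q.continuous.Icc_extend'
  obtain ⟨C, hC⟩ := isCompact_Icc.exists_bound_of_continuousOn hc
  have hm : MemLp h 2 μD := MemLp.of_bound
    ((hc.mono Ioo_subset_Icc_self).aestronglyMeasurable measurableSet_Ioo) C
    ((ae_restrict_iff' measurableSet_Ioo).2
      (Eventually.of_forall fun x hx => hC x (Ioo_subset_Icc_self hx)))
  set e : L2 := hm.toLp h
  set w : L2 := g - ω ^ 2 • mulL (coeffL q) e
  have hw : (w : ℝ → ℂ) =ᵐ[μD] fun x => g x + -(ω ^ 2 * coeff q x * h x) := by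
    filter_upwards [Lp.coeFn_sub g (ω ^ 2 • mulL (coeffL q) e),
      Lp.coeFn_smul (ω ^ 2) (mulL (coeffL q) e), mulL_ae (coeffL q) e, coeffL_ae q,
      hm.coeFn_toLp] with x h1 h2 h3 h4 h5
    rw [h1, Pi.sub_apply, h2, Pi.smul_apply, h3, h4, h5, smul_eq_mul]
    ring
  have hcq : ContinuousOn (fun x => -(ω ^ 2 * coeff q x * h x)) (Icc 0 1) := by fun_prop
  have hrep : IsH2Rep h dh e w := by
    refine ⟨hm.coeFn_toLp, fun x hx => (hd x hx).1, fun x hx => ?_⟩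
    have h1 := integral_eq_of_hasDerivWithinAt (fun y hy => (hd y hy).2) hcq hx
    have h2 : ∫ t in (0 : ℝ)..x, w t
        = ∫ t in (0 : ℝ)..x, (g t + -(ω ^ 2 * coeff q t * h t)) := by
      rw [intervalIntegral.integral_of_le hx.1, intervalIntegral.integral_of_le hx.1,
        integral_Ioc_eq_integral_Ioo, integral_Ioc_eq_integral_Ioo]
      exact integral_congr_ae (ae_restrict_of_ae_restrict_of_subset
        (Ioo_subset_Ioo_right hx.2) hw)
    rw [h2, intervalIntegral.integral_add (L2.intervalIntegrable g hx)
      ((hcq.mono (Icc_subset_Icc_right hx.2)).intervalIntegrable_of_Icc hx.1), ← W_eq g hx]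
    have h3 : W g 0 = 0 := by simp [W]
    rw [h3] at h1
    linear_combination h1
  refine ⟨⟨WithLp.toLp 2 (e, w), h, dh, hrep, h0⟩, hm.coeFn_toLp, ?_⟩
  change w + ω ^ 2 • mulL (coeffL q) e = g
  simp [w]

lemma exists_opL_eq_aSol (q : C(Icc (0 : ℝ) 1, ℝ)) (ω : ℂ) (g : L2) :
    ∃ u : H2diamond, (opE u : ℝ → ℂ) =ᵐ[μD] aSol q g ω ∧ opL q ω u = g := by
  obtain ⟨da, hda⟩ := aSol_hasDeriv q g ω
  exact exists_opL_eq g (by simp [aSol]) hda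

lemma exists_opL_eq_zSol (q : C(Icc (0 : ℝ) 1, ℝ)) (ω : ℂ) :
    ∃ u : H2diamond, (opE u : ℝ → ℂ) =ᵐ[μD] zSol q ω ∧ opL q ω u = 0 := by
  obtain ⟨z', hz0, -, hz⟩ := ivpSol_spec q ω 0 1
  refine exists_opL_eq (dh := z') 0 hz0 fun x hx => ⟨(hz x hx).1, ?_⟩
  have : (fun y => z' y - W 0 y) = z' := by
    ext y
    have := W_smul 0 0 y
    simp only [zero_smul, zero_mul] at this
    rw [this, sub_zero]
  rw [this]
  exact (hz x hx).2

/-- Regularity: the equation makes `u''` agree almost everywhere with a continuous function, so the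
`C¹` representative is a classical solution vanishing at `0`, and its slope there is the factor. -/
lemma exists_eq_smul_zSol {q : C(Icc (0 : ℝ) 1, ℝ)} {ω : ℂ} {u : H2diamond}
    (hu : opL q ω u = 0) : ∃ c : ℂ, (opE u : ℝ → ℂ) =ᵐ[μD] fun x => c * zSol q ω x := by
  obtain ⟨h, dh, hr, h0⟩ := u.2
  have hc : ContinuousOn h (Icc 0 1) := fun x hx => (hr.hasDeriv x hx).continuousWithinAt
  have hq : Continuous (coeff q) := q.continuous.Icc_extend'
  have hcq : ContinuousOn (fun x => -(ω ^ 2 * coeff q x * h x)) (Icc 0 1) := by fun_prop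
  have hw : (opD u : ℝ → ℂ) =ᵐ[μD] fun x => -(ω ^ 2 * coeff q x * h x) := by
    have hu' : opD u = -(ω ^ 2 • opQ q u) := eq_neg_of_add_eq_zero_left hu
    filter_upwards [Lp.coeFn_neg (ω ^ 2 • opQ q u), Lp.coeFn_smul (ω ^ 2) (opQ q u), opQ_ae q u,
      hr.ae_eq] with x h1 h2 h3 h4
    rw [hu', h1, Pi.neg_apply, h2, Pi.smul_apply, h3, opE_apply, h4, smul_eq_mul]
    ring
  have hdh : ∀ x ∈ Icc (0 : ℝ) 1,
      dh x = dh 0 + ∫ t in (0 : ℝ)..x, -(ω ^ 2 * coeff q t * h t) := fun x hx => by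
    rw [hr.deriv_eq x hx, intervalIntegral.integral_of_le hx.1,
      intervalIntegral.integral_of_le hx.1, integral_Ioc_eq_integral_Ioo,
      integral_Ioc_eq_integral_Ioo]
    congr 1
    exact integral_congr_ae (ae_restrict_of_ae_restrict_of_subset (Ioo_subset_Ioo_right hx.2) hw)
  have hsol : IsIVPSolution q ω 0 (dh 0) h := ⟨dh, h0, rfl, fun x hx => ⟨hr.hasDeriv x hx,
    ((hasDerivWithinAt_primitive hcq hx).const_add (dh 0)).congr_of_mem hdh hx⟩⟩
  refine ⟨dh 0, ?_⟩
  filter_upwards [hr.ae_eq, ae_restrict_mem measurableSet_Ioo] with x h1 h2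
  rw [opE_apply, h1, hsol.eq_combination (Ioo_subset_Icc_self h2)]
  ring

lemma eq_smul_of_opL_eq_zero {q : C(Icc (0 : ℝ) 1, ℝ)} {ω : ℂ} {u v : H2diamond}
    (hu : opL q ω u = 0) (hv : opL q ω v = 0) (hvz : (opE v : ℝ → ℂ) =ᵐ[μD] zSol q ω) :
    ∃ c : ℂ, u = c • v := by
  obtain ⟨c, hc⟩ := exists_eq_smul_zSol hu
  have hE : opE u = opE (c • v) := by
    rw [map_smul]
    refine Lp.ext ?_
    filter_upwards [hc, Lp.coeFn_smul c (opE v), hvz] with x h1 h2 h3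
    rw [h1, h2, Pi.smul_apply, h3, smul_eq_mul]
  refine ⟨c, H2diamond_ext hE ?_⟩
  have h1 : opD u = -(ω ^ 2 • opQ q u) := eq_neg_of_add_eq_zero_left hu
  have h2 : opD v = -(ω ^ 2 • opQ q v) := eq_neg_of_add_eq_zero_left hv
  have h3 : opQ q u = c • opQ q v := by
    rw [opQ, ContinuousLinearMap.comp_apply, hE, map_smul, map_smul]; rfl
  rw [map_smul, h1, h2, h3, smul_comm, smul_neg]

open ContinuousLinearMap (adjoint)

/-! ### Two facts of functional analysis -/

/-- The range of the adjoint of a surjective operator is the orthogonal complement of the kernel. -/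
lemma exists_adjoint_eq {E F : Type*} [NormedAddCommGroup E] [InnerProductSpace ℂ E]
    [CompleteSpace E] [NormedAddCommGroup F] [InnerProductSpace ℂ F] [CompleteSpace F]
    {T : E →L[ℂ] F} (hT : Function.Surjective T) {y : E}
    (hy : ∀ x, T x = 0 → inner ℂ x y = 0) : ∃ v, adjoint T v = y := by
  -- The open mapping theorem gives preimages of controlled norm. Pairing such a preimage of `v`
  -- with `T* v` bounds `T*` from below, so its range is closed and equals the orthogonal complement
  -- of `ker T`.
  obtain ⟨C, hC, hpre⟩ := T.exists_preimage_norm_le hT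
  have hbound : ∀ v, ‖v‖ ≤ C * ‖adjoint T v‖ := fun v => by
    obtain ⟨x, hx, hxv⟩ := hpre v
    rcases (norm_nonneg v).eq_or_lt with h0 | h0
    · rw [← h0]; positivity
    · have h1 : ‖v‖ * ‖v‖ ≤ ‖x‖ * ‖adjoint T v‖ := by
        have := norm_inner_le_norm (𝕜 := ℂ) x (adjoint T v)
        rwa [ContinuousLinearMap.adjoint_inner_right, hx, inner_self_eq_norm_sq_to_K, norm_pow,
          RCLike.norm_ofReal, abs_norm, sq] at this
      nlinarith [norm_nonneg (adjoint T v), norm_nonneg x]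
  have hanti : AntilipschitzWith (Real.toNNReal C) (adjoint T) :=
    AddMonoidHomClass.antilipschitz_of_bound _ fun v => by
      rw [Real.coe_toNNReal _ hC.le]; exact hbound v
  have hcl : IsClosed ((adjoint T).range : Set E) := by
    rw [LinearMap.coe_range]
    exact hanti.isClosed_range (adjoint T).uniformContinuous
  have hmem : y ∈ T.kerᗮ := fun x hx => hy x hx
  rw [T.orthogonal_ker, hcl.submodule_topologicalClosure_eq] at hmem
  exact hmem

/-- Solvability of `F (p, x) = F (p₀, x₀)` near `p₀` when the partial derivative of `F` in `x` is
onto. -/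
lemma eventually_exists_eq {P X Y : Type*} [NormedAddCommGroup P] [NormedSpace ℝ P]
    [CompleteSpace P] [NormedAddCommGroup X] [NormedSpace ℝ X] [CompleteSpace X]
    [NormedAddCommGroup Y] [NormedSpace ℝ Y] [CompleteSpace Y] {F : P × X → Y}
    (hF : ContDiff ℝ 1 F) (p₀ : P) (x₀ : X)
    (hs : ∀ y, ∃ v, HasDerivAt (fun t : ℝ => F (p₀, x₀ + t • v)) y 0) :
    ∀ᶠ p in 𝓝 p₀, ∃ x, F (p, x) = F (p₀, x₀) := by
  have hstrict := hF.contDiffAt.hasStrictFDerivAt (x := (p₀, x₀)) one_ne_zero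
  set F' := fderiv ℝ F (p₀, x₀)
  -- Adjoining the parameter to the values reduces the claim to local openness of one map with
  -- surjective derivative. The kernel of the partial derivative may be nontrivial: only existence
  -- of `x` is needed.
  have hG : HasStrictFDerivAt (fun z : P × X => (z.1, F z))
      ((ContinuousLinearMap.fst ℝ P X).prod F') (p₀, x₀) :=
    hasStrictFDerivAt_fst.prodMk hstrict
  have hsurj : ∀ y, ∃ v, F' (0, v) = y := fun y => by
    obtain ⟨v, hv⟩ := hs y
    have h1 : HasDerivAt (fun t : ℝ => ((p₀, x₀ + t • v) : P × X)) (0, v) 0 := by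
      refine (hasDerivAt_const _ _).prodMk ?_
      simpa using ((hasDerivAt_id (0 : ℝ)).smul_const v).const_add x₀
    have h2 : HasFDerivAt F F' ((fun t : ℝ => ((p₀, x₀ + t • v) : P × X)) 0) := by
      simpa using hstrict.hasFDerivAt
    exact ⟨v, (h2.comp_hasDerivAt 0 h1).unique hv⟩
  have hrange : ((ContinuousLinearMap.fst ℝ P X).prod F').range = ⊤ := by
    rw [LinearMap.range_eq_top]
    rintro ⟨p, y⟩
    obtain ⟨v, hv⟩ := hsurj (y - F' (p, 0))
    refine ⟨(p, v), Prod.ext rfl ?_⟩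
    have : ((p, v) : P × X) = (p, 0) + (0, v) := by simp
    change F' (p, v) = y
    rw [this, map_add, hv, add_sub_cancel]
  have hmap := hG.map_nhds_eq_of_surj hrange
  have h3 : ∀ᶠ z in 𝓝 (p₀, F (p₀, x₀)), ∃ w : P × X, (w.1, F w) = z := by
    have : ∀ᶠ z in map (fun z : P × X => (z.1, F z)) (𝓝 (p₀, x₀)),
        ∃ w : P × X, (w.1, F w) = z := eventually_map.2 (Eventually.of_forall fun w => ⟨w, rfl⟩)
    rwa [hmap] at this
  have h4 : Tendsto (fun p : P => (p, F (p₀, x₀))) (𝓝 p₀) (𝓝 (p₀, F (p₀, x₀))) :=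
    (Continuous.prodMk_left _).tendsto p₀
  filter_upwards [h4.eventually h3] with p ⟨w, hw⟩
  obtain ⟨rfl, h⟩ := Prod.ext_iff.1 hw
  exact ⟨w.2, h⟩

/-! ### The operator `T⋄_ω` as a smooth map -/

/-- The operator `T⋄_ω`, with the parameters `χ₁` and `ω` as variables. -/
def mapT (q : C(Icc (0 : ℝ) 1, ℝ)) (χ₂ : Linfty) (p : (Linfty × ℂ) × (H2diamond × L2)) :
    H2diamond × L2 :=
  (adjoint (opL q (2 * conj p.1.2)) p.2.2 + p.1.2 ^ 2 • adjoint opE (bil χ₂ p.2.1 p.2.1),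
    opL q p.1.2 p.2.1 + p.1.2 ^ 2 • mulL p.1.1 (mulL (conjL (opJ p.2.1)) p.2.2))

/-- The adjoint conjugates scalars, which undoes the conjugate of `ω` and leaves a polynomial in
`ω`. -/
lemma adjoint_opL (q : C(Icc (0 : ℝ) 1, ℝ)) (ω : ℂ) (v : L2) :
    adjoint (opL q (2 * conj ω)) v = adjoint opD v + (4 * ω ^ 2) • adjoint (opQ q) v := by
  rw [opL, map_add, map_smulₛₗ]
  change _ + conj ((2 * conj ω) ^ 2) • adjoint (opQ q) v = _
  simp only [map_pow, map_mul, map_ofNat, Complex.conj_conj, mul_pow]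
  norm_num

/-- Only boundedness of the linear and bilinear ingredients matters. Smoothness is over `ℝ` because
`c`, which stands for conjugation, is merely real linear. -/
lemma contDiff_quadratic {A H K : Type*} [NormedAddCommGroup A] [NormedSpace ℂ A]
    [NormedSpace ℝ A] [IsScalarTower ℝ ℂ A] [NormedAddCommGroup H] [NormedSpace ℂ H]
    [NormedSpace ℝ H] [IsScalarTower ℝ ℂ H] [NormedAddCommGroup K] [NormedSpace ℂ K]
    [NormedSpace ℝ K] [IsScalarTower ℝ ℂ K] (m : A →L[ℂ] K →L[ℂ] K) (c : A →L[ℝ] A)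
    (J : H →L[ℂ] A) (E D Q : H →L[ℂ] K) (D' Q' E' : K →L[ℂ] H) (a : A) :
    ContDiff ℝ 1 (fun p : (A × ℂ) × (H × K) =>
      (D' p.2.2 + (4 * p.1.2 ^ 2) • Q' p.2.2 + p.1.2 ^ 2 • E' (m a (m (J p.2.1) (E p.2.1))),
        D p.2.1 + p.1.2 ^ 2 • Q p.2.1 + p.1.2 ^ 2 • m p.1.1 (m (c (J p.2.1)) p.2.2))) := by
  have hmul : ContDiff ℝ 1 (fun z : A × K => m z.1 z.2) :=
    (m.isBoundedBilinearMap.contDiff (n := 1)).restrict_scalars ℝ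
  have hω : ContDiff ℝ 1 (fun p : (A × ℂ) × (H × K) => p.1.2 ^ 2) := by fun_prop
  have hu : ContDiff ℝ 1 (fun p : (A × ℂ) × (H × K) => p.2.1) := by fun_prop
  have hv : ContDiff ℝ 1 (fun p : (A × ℂ) × (H × K) => p.2.2) := by fun_prop
  have hχ : ContDiff ℝ 1 (fun p : (A × ℂ) × (H × K) => p.1.1) := by fun_prop
  have hJ := (J.restrictScalars ℝ).contDiff.comp hu
  have hE := (E.restrictScalars ℝ).contDiff.comp hu
  refine ContDiff.prodMk ?_ ?_
  · refine (((D'.restrictScalars ℝ).contDiff.comp hv).add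
      ((contDiff_const.mul hω).smul ((Q'.restrictScalars ℝ).contDiff.comp hv))).add (hω.smul ?_)
    exact (E'.restrictScalars ℝ).contDiff.comp
      (((m a).restrictScalars ℝ).contDiff.comp (hmul.comp (hJ.prodMk hE)))
  · refine (((D.restrictScalars ℝ).contDiff.comp hu).add
      (hω.smul ((Q.restrictScalars ℝ).contDiff.comp hu))).add (hω.smul ?_)
    exact hmul.comp (hχ.prodMk (hmul.comp ((c.contDiff.comp hJ).prodMk hv)))

lemma contDiff_mapT (q : C(Icc (0 : ℝ) 1, ℝ)) (χ₂ : Linfty) : ContDiff ℝ 1 (mapT q χ₂) := by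
  convert! contDiff_quadratic mulL conjL opJ opE opD (opQ q) (adjoint opD) (adjoint (opQ q))
    (adjoint opE) χ₂ using 2 with p
  refine Prod.ext ?_ rfl
  rw [mapT, adjoint_opL]
  rfl

lemma H2diamond_inner_smul_left (c : ℂ) (u v : H2diamond) :
    inner ℂ (c • u) v = conj c * inner ℂ u v := inner_smul_left u v c

lemma H2diamond_inner_smul_right (c : ℂ) (u v : H2diamond) :
    inner ℂ u (c • v) = c * inner ℂ u v := inner_smul_right u v c

/-- Testing against `φ₁` and `φ₂` separately moves the derivatives and the embedding onto adjoints,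
which gives the strong form of the equation. -/
lemma Tdiamond_eq (q : C(Icc (0 : ℝ) 1, ℝ)) (χ₁ χ₂ : Linfty) (ω : ℂ) (u : H2diamond) (v : L2) :
    Tdiamond q χ₁ χ₂ ω (WithLp.toLp 2 (u, v)) =
      WithLp.toLp 2 (mapT q χ₂ ((χ₁, ω), (u, v))) := by
  refine ext_inner_left ℂ fun φ => ?_
  rw [← inner_Tdiamond, WithLp.prod_inner_apply]
  set φ₁ : H2diamond := φ.fst
  set φ₂ : L2 := φ.snd
  have h2 : inner ℂ φ₂ (opL q ω u + ω ^ 2 • mulL χ₁ (mulL (conjL (opJ u)) v)) =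
      ∫ x in D, ((opD u x + ω ^ 2 * coeff q x * opE u x) * conj (φ₂ x)
      + ω ^ 2 / x * χ₁ x * v x * conj (opE u x) * conj (φ₂ x)) := by
    rw [L2.inner_def]
    apply integral_congr_ae
    have hL : opL q ω u = opD u + ω ^ 2 • opQ q u := rfl
    rw [hL]
    filter_upwards [Lp.coeFn_add (opD u + ω ^ 2 • opQ q u)
        (ω ^ 2 • mulL χ₁ (mulL (conjL (opJ u)) v)),
      Lp.coeFn_add (opD u) (ω ^ 2 • opQ q u), Lp.coeFn_smul (ω ^ 2) (opQ q u), opQ_ae q u,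
      Lp.coeFn_smul (ω ^ 2) (mulL χ₁ (mulL (conjL (opJ u)) v)),
      mulL_ae χ₁ (mulL (conjL (opJ u)) v), mulL_ae (conjL (opJ u)) v, conjL_ae (opJ u),
      opJ_ae u] with x h1 h2 h3 h4 h5 h6 h7 h8 h9
    rw [h1, Pi.add_apply, h2, Pi.add_apply, h3, Pi.smul_apply, h4, h5, Pi.smul_apply, h6, h7, h8,
      h9, RCLike.inner_apply, map_div₀, Complex.conj_ofReal]
    simp only [smul_eq_mul]
    ring
  have h1 : inner ℂ φ₁ (adjoint (opL q (2 * conj ω)) v + ω ^ 2 • adjoint opE (bil χ₂ u u)) =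
      ∫ x in D, (v x * (conj (opD φ₁ x) + 4 * ω ^ 2 * coeff q x * conj (opE φ₁ x))
      + ω ^ 2 / x * χ₂ x * opE u x ^ 2 * conj (opE φ₁ x)) := by
    rw [inner_add_right, H2diamond_inner_smul_right, ContinuousLinearMap.adjoint_inner_right,
      ContinuousLinearMap.adjoint_inner_right, ← inner_smul_right]
    simp only [L2.inner_def]
    rw [← integral_add (L2.integrable_inner _ _) (L2.integrable_inner _ _)]
    apply integral_congr_ae
    have hL : opL q (2 * conj ω) φ₁ = opD φ₁ + (2 * conj ω) ^ 2 • opQ q φ₁ := rfl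
    rw [hL]
    filter_upwards [Lp.coeFn_add (opD φ₁) ((2 * conj ω) ^ 2 • opQ q φ₁),
      Lp.coeFn_smul ((2 * conj ω) ^ 2) (opQ q φ₁), opQ_ae q φ₁, bil_ae χ₂ u u,
      Lp.coeFn_smul (ω ^ 2) (bil χ₂ u u)] with x h1 h2 h3 h4 h5
    rw [h1, Pi.add_apply, h2, Pi.smul_apply, h3, h5, Pi.smul_apply, h4, RCLike.inner_apply,
      RCLike.inner_apply]
    simp only [smul_eq_mul, map_add, map_mul, map_pow, map_ofNat, Complex.conj_conj,
      Complex.conj_ofReal]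
    ring
  change formT q χ₁ χ₂ ω (WithLp.toLp 2 (u, v)) φ = inner ℂ φ₁ _ + inner ℂ φ₂ _
  simp only [mapT]
  rw [h1, h2, add_comm]
  rfl

/-! ### The linearization at `χ₁ = 0` -/

/-- A nonzero discriminant makes the root simple, and `a t + b` is half the derivative there. If `a
= 0` the equation is linear with slope `2b ≠ 0`. -/
lemma exists_root {a b c : ℂ} (h : b ^ 2 - a * c ≠ 0) :
    ∃ t : ℂ, a * t ^ 2 + 2 * b * t + c = 0 ∧ a * t + b ≠ 0 := by
  by_cases ha : a = 0
  · subst ha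
    have hb : b ≠ 0 := fun hb => h (by simp [hb])
    exact ⟨-c / (2 * b), by field_simp; ring, by simpa using hb⟩
  · obtain ⟨s, hs⟩ := IsAlgClosed.exists_pow_nat_eq (b ^ 2 - a * c) (n := 2) (by norm_num)
    have hs0 : s ≠ 0 := fun h0 => h (by rw [← hs, h0]; ring)
    refine ⟨(s - b) / a, ?_, ?_⟩
    · field_simp
      linear_combination hs
    · rw [mul_div_cancel₀ _ ha, sub_add_cancel]; exact hs0

/-- The form `(u, v) ↦ ∫ u v z_{2ω} χ₂ dx / x`. -/
def tau (χ : Linfty) (ψ u v : H2diamond) : ℂ := inner ℂ (opE ψ) (bil χ u v)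

lemma bil_add_left (χ : Linfty) (u v w : H2diamond) : bil χ (u + v) w = bil χ u w + bil χ v w := by
  simp [bil]

lemma bil_add_right (χ : Linfty) (u v w : H2diamond) :
    bil χ u (v + w) = bil χ u v + bil χ u w := by
  simp [bil]

lemma bil_smul_left (χ : Linfty) (c : ℂ) (u v : H2diamond) : bil χ (c • u) v = c • bil χ u v := by
  simp [bil]

lemma bil_smul_right (χ : Linfty) (c : ℂ) (u v : H2diamond) : bil χ u (c • v) = c • bil χ u v := by
  simp [bil]

lemma tau_eq {q : C(Icc (0 : ℝ) 1, ℝ)} {ω : ℂ} {ψ u v : H2diamond} (χ : Linfty) {h k : ℝ → ℂ}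
    (hψ : (opE ψ : ℝ → ℂ) =ᵐ[μD] zSol q (2 * conj ω)) (hu : (opE u : ℝ → ℂ) =ᵐ[μD] h)
    (hv : (opE v : ℝ → ℂ) =ᵐ[μD] k) :
    tau χ ψ u v = ∫ x in D, h x * k x * zSol q (2 * ω) x * (χ x / x) := by
  rw [tau, L2.inner_def]
  apply integral_congr_ae
  filter_upwards [bil_ae χ u v, hψ, hu, hv, ae_restrict_mem measurableSet_Ioo]
    with x h1 h2 h3 h4 h5
  rw [h1, h2, h3, h4, RCLike.inner_apply, conj_zSol q _ (Ioo_subset_Icc_self h5)]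
  simp only [map_mul, map_ofNat, Complex.conj_conj]
  ring

/-- The linearized system at `χ₁ = 0` around a solution `u` with `∫ u z_ω z_{2ω} χ₂ dx / x ≠ 0`. -/
lemma exists_linearized_eq {q : C(Icc (0 : ℝ) 1, ℝ)} {χ : Linfty} {ω : ℂ} {ψ z u : H2diamond}
    (hω : ω ≠ 0) (hψ : (opE ψ : ℝ → ℂ) =ᵐ[μD] zSol q (2 * conj ω))
    (hψ0 : opL q (2 * conj ω) ψ = 0) (hz : opL q ω z = 0) (hu : tau χ ψ u z ≠ 0)
    (y₁ : H2diamond) (y₂ : L2) : ∃ (v : H2diamond) (w : L2), opL q ω v = y₂ ∧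
      adjoint (opL q (2 * conj ω)) w + (2 * ω ^ 2) • adjoint opE (bil χ u v) = y₁ := by
  obtain ⟨v₀, -, hv₀⟩ := exists_opL_eq_aSol q ω y₂
  -- The multiple of `z` is chosen so that the remaining right-hand side is orthogonal to `ψ`, which
  -- spans the kernel of `L_{2ω̄}`. Both `ω ≠ 0` and `hu` are needed to divide.
  set c : ℂ := (inner ℂ ψ y₁ - 2 * ω ^ 2 * tau χ ψ u v₀) / (2 * ω ^ 2 * tau χ ψ u z) with hc
  have hsurj : Function.Surjective (opL q (2 * conj ω)) := fun g => by
    obtain ⟨x, -, hx⟩ := exists_opL_eq_aSol q (2 * conj ω) g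
    exact ⟨x, hx⟩
  obtain ⟨w, hw⟩ := exists_adjoint_eq hsurj
    (y := y₁ - (2 * ω ^ 2) • adjoint opE (bil χ u (v₀ + c • z))) fun x hx => by
      obtain ⟨d, rfl⟩ := eq_smul_of_opL_eq_zero hx hψ0 hψ
      have key : inner ℂ ψ y₁ - 2 * ω ^ 2 * (tau χ ψ u v₀ + c * tau χ ψ u z) = 0 := by
        rw [hc]; field_simp; ring
      rw [H2diamond_inner_smul_left, inner_sub_right, H2diamond_inner_smul_right,
        ContinuousLinearMap.adjoint_inner_right, bil_add_right, bil_smul_right, inner_add_right,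
        inner_smul_right]
      exact mul_eq_zero_of_right _ key
  exact ⟨v₀ + c • z, w, by rw [map_add, map_smul, hz, hv₀, smul_zero, add_zero],
    by rw [hw, sub_add_cancel]⟩

/-- The simple root `t` does double duty: being a root makes the system at `χ₁ = 0` solvable with
`u₁ = a + t z`, and being simple makes the linearization there onto. Openness in `ω` as well as in
`χ₁` is what the compactness argument uses. -/
lemma eventually_exists_mapT_eq {q : C(Icc (0 : ℝ) 1, ℝ)} {χ₂ : Linfty} {f : L2} {ω : ℂ}
    (hω : ω ≠ 0) (hζ : zeta q χ₂ f ω ≠ 0) :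
    ∀ᶠ p in 𝓝 ((0 : Linfty), ω), ∃ x, mapT q χ₂ (p, x) = (0, f) := by
  obtain ⟨a, ha, hLa⟩ := exists_opL_eq_aSol q ω f
  obtain ⟨z, hz, hLz⟩ := exists_opL_eq_zSol q ω
  obtain ⟨ψ, hψ, hLψ⟩ := exists_opL_eq_zSol q (2 * conj ω)
  have hζ' : tau χ₂ ψ z a ^ 2 - tau χ₂ ψ z z * tau χ₂ ψ a a ≠ 0 := by
    rw [tau_eq χ₂ hψ hz ha, tau_eq χ₂ hψ hz hz, tau_eq χ₂ hψ ha ha]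
    simpa only [zeta, sq] using hζ
  obtain ⟨t, ht, ht'⟩ := exists_root hζ'
  have hsym : tau χ₂ ψ a z = tau χ₂ ψ z a := by rw [tau, bil_comm, tau]
  set u := a + t • z
  have hLu : opL q ω u = f := by rw [map_add, map_smul, hLz, hLa, smul_zero, add_zero]
  have huz : tau χ₂ ψ u z ≠ 0 := by
    have : tau χ₂ ψ u z = tau χ₂ ψ z z * t + tau χ₂ ψ z a := by
      rw [← hsym, tau, bil_add_left, bil_smul_left, inner_add_right, inner_smul_right]
      simp only [tau]; ring
    rwa [this]
  have huu : tau χ₂ ψ u u = 0 := by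
    have : tau χ₂ ψ u u = tau χ₂ ψ z z * t ^ 2 + tau χ₂ ψ a z * t + tau χ₂ ψ z a * t
        + tau χ₂ ψ a a := by
      simp only [tau, u, bil_add_left, bil_add_right, bil_smul_left, bil_smul_right,
        inner_add_right, inner_smul_right]
      ring
    rw [this, hsym]; linear_combination ht
  have hsurj : Function.Surjective (opL q (2 * conj ω)) := fun g => by
    obtain ⟨x, -, hx⟩ := exists_opL_eq_aSol q (2 * conj ω) g
    exact ⟨x, hx⟩
  obtain ⟨v, hv⟩ := exists_adjoint_eq hsurj
    (y := -(ω ^ 2 • adjoint opE (bil χ₂ u u))) fun x hx => by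
      obtain ⟨d, rfl⟩ := eq_smul_of_opL_eq_zero hx hLψ hψ
      rw [H2diamond_inner_smul_left, inner_neg_right, H2diamond_inner_smul_right,
        ContinuousLinearMap.adjoint_inner_right]
      change _ * -(_ * tau χ₂ ψ u u) = 0
      rw [huu]; simp
  have hbase : mapT q χ₂ (((0 : Linfty), ω), (u, v)) = (0, f) := by
    simp [mapT, hv, hLu]
  rw [← hbase]
  refine eventually_exists_eq (contDiff_mapT q χ₂) _ _ fun y => ?_
  obtain ⟨v', w', h2, h1⟩ := exists_linearized_eq hω hψ hLψ hLz huz y.1 y.2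
  refine ⟨(v', w'), ?_⟩
  -- At `χ₁ = 0` the conjugate term drops out and the map is exactly quadratic along the line, with
  -- linear coefficient `y` by the choice of `v'` and `w'`.
  have hexp : (fun s : ℝ => mapT q χ₂ (((0 : Linfty), ω), (u, v) + s • (v', w'))) =
      fun s : ℝ => (0, f) + s • y + s ^ 2 • (ω ^ 2 • adjoint opE (bil χ₂ v' v'), (0 : L2)) := by
    ext1 s
    have hu' : ((u, v) + s • (v', w') : H2diamond × L2) =
        (u + (s : ℂ) • v', v + (s : ℂ) • w') := rfl
    have hy : (0, f) + s • y + s ^ 2 • (ω ^ 2 • adjoint opE (bil χ₂ v' v'), (0 : L2)) =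
        (0 + (s : ℂ) • y.1 + ((s ^ 2 : ℝ) : ℂ) • ω ^ 2 • adjoint opE (bil χ₂ v' v'),
          f + (s : ℂ) • y.2 + ((s ^ 2 : ℝ) : ℂ) • (0 : L2)) := rfl
    rw [hu', hy]
    refine Prod.ext ?_ ?_
    · change adjoint (opL q (2 * conj ω)) (v + (s : ℂ) • w') + ω ^ 2 • adjoint opE
        (bil χ₂ (u + (s : ℂ) • v') (u + (s : ℂ) • v')) = _
      simp only [← h1, bil_add_left, bil_add_right, bil_smul_left, bil_smul_right, map_add,
        map_smul, hv, bil_comm χ₂ v' u]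
      push_cast
      module
    · change opL q ω (u + (s : ℂ) • v') + ω ^ 2 • mulL 0 _ = _
      rw [map_add, map_smul, hLu, h2]
      simp
  rw [hexp]
  have h3 := (((hasDerivAt_id (0 : ℝ)).smul_const y).const_add ((0, f) : H2diamond × L2)).add
    ((hasDerivAt_pow 2 (0 : ℝ)).smul_const (ω ^ 2 • adjoint opE (bil χ₂ v' v'), (0 : L2)))
  convert! h3 using 1
  simp

end RadialSHG

end

theorem mainTheorem2 (q : C(Set.Icc (0 : ℝ) 1, ℝ)) (χ₂ : RadialSHG.Linfty) (f : RadialSHG.L2)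
    (hf : f ≠ 0) (ρ δ : ℝ) (hρ : 0 < ρ) (hδ : 0 < δ) :
    ∃ c : ℝ, 0 < c ∧ ∀ χ₁ : RadialSHG.Linfty, ‖χ₁‖ < c →
      ∀ ω ∈ RadialSHG.setG q χ₂ f ρ δ, ∃ u : RadialSHG.Xdiamond,
        RadialSHG.Tdiamond q χ₁ χ₂ ω u = RadialSHG.source f := by
  have hclosed : IsClosed (RadialSHG.setG q χ₂ f ρ δ) :=
    (isClosed_le continuous_norm continuous_const).inter
      (isClosed_le continuous_const (Metric.continuous_infDist_pt _))
  have hcompact : IsCompact (RadialSHG.setG q χ₂ f ρ δ) :=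
    (isCompact_closedBall (0 : ℂ) ρ).of_isClosed_subset hclosed fun ω hω => by
      simpa using hω.1
  -- Tube-lemma argument: neighbourhoods of each `(0, ω)` combine over the compact set into a single
  -- neighbourhood of `χ₁ = 0`. Positive distance to `Λ` supplies `ζ(ω) ≠ 0` and `ω ≠ 0`.
  have hev := hcompact.eventually_forall_of_forall_eventually (x₀ := (0 : RadialSHG.Linfty))
    (P := fun χ₁ ω => ∃ x, RadialSHG.mapT q χ₂ ((χ₁, ω), x) = (0, f)) fun ω hω => by
      have hΛ : ω ∉ RadialSHG.Lam q χ₂ f := fun h => by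
        have := hω.2
        rw [Metric.infDist_zero_of_mem h] at this
        exact hδ.not_ge this
      simp only [RadialSHG.Lam, mem_union, mem_ofPred_eq, mem_singleton_iff, not_or] at hΛ
      exact RadialSHG.eventually_exists_mapT_eq hΛ.2 hΛ.1
  obtain ⟨c, hc, hball⟩ := Metric.eventually_nhds_iff.1 hev
  refine ⟨c, hc, fun χ₁ hχ₁ ω hω => ?_⟩
  obtain ⟨⟨u, v⟩, huv⟩ := hball (by simpa using hχ₁) ω hω
  exact ⟨WithLp.toLp 2 (u, v), by rw [RadialSHG.Tdiamond_eq, huv]; rfl⟩
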